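/- **Theorem (simple-EVD for correlated PCA).** Let $\|\cdot\|$ be the Euclidean norm of a vector and the induced operator norm of a matrix. Let $1\le r\le n$ and $\alpha\ge 1$ be integers, let $P\in\mathbb R^{n\times r}$ have orthonormal columns, and let the data be $$y_t=\ell_t+M_t\ell_t,\qquad \ell_t=Pa_t,\qquad t=1,\dots,\alpha,$$ with deterministic matrices $M_t\in\mathbb R^{n\times n}$. Assume: (1) The $a_t$ are mutually independent zero-mean random vectors in $\mathbb R^r$ with a common diagonal covariance matrix $\Lambda=\mathrm{diag}(\lambda_1,\dots,\lambda_r)$, $\lambda_j>0$, and $(a_t)_j^2\le\eta\lambda_j$ almost surely for all $t,j$ and a constant $\eta$. Put $\lambda^-=\min_j\lambda_j$, $\lambda^+=\max_j\lambda_j$, $f=\lambda^+/\lambda^-$. (2) $M_t=M_{2,t}M_{1,t}$ with $\|M_{1,t}P\|\le q<1$ and $\|M_{2,t}\|\le1$ for all $t$, and there is $\beta<\alpha$ such that for every sequence of symmetric positive semidefinite matrices $A_t$ of the appropriate sizes $$\Big\|\frac1\alpha\sum_{t=1}^\alpha M_{2,t}A_tM_{2,t}'\Big\|\le\frac\beta\alpha\max_{1\le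 t\le\alpha}\|A_t\| .$$ Let $\zeta>0$ with $r\zeta\le0.01$ and suppose that $$\frac\beta\alpha\le\Big(\frac{1-r\zeta}2\Big)^2\min\Big(\frac{(r\zeta)^2}{4.1(qf)^2},\frac{r\zeta}{q^2f}\Big)$$ (no condition if $q=0$), and $$\alpha\ge\alpha_0:=C\eta^2\,\frac{r^2\,11\log n}{(r\zeta)^2}\,\max(f,qf,q^2f)^2,\qquad C=\frac{32}{0.01^2}.$$ Let $\hat P$ be the matrix whose columns are all the vectors of an orthonormal eigenbasis of $\frac1\alpha\sum_{t=1}^\alpha y_ty_t'$ with eigenvalue above $0.95\lambda^-$. Then with probability at least $1-6n^{-10}$ (simultaneously for all choices of the eigenbasis), $$\mathrm{SE}(\hat P,P):=\|(I-\hat P\hat P')P\|\le r\zeta .$$ -/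

import Mathlib

open MeasureTheory ProbabilityTheory
open scoped Matrix Matrix.Norms.L2Operator

/-- A basis matrix: a real matrix with orthonormal columns. -/
def IsBasisMatrix {n r : ℕ} (P : Matrix (Fin n) (Fin r) ℝ) : Prop :=
  Pᵀ * P = 1

/-- Subspace error `‖(I - P̂ P̂') P‖` in the induced `ℓ₂` norm. -/
noncomputable def subspaceError {n r : ℕ} {ι : Type} [Fintype ι]
    (Phat : Matrix (Fin n) ι ℝ) (P : Matrix (Fin n) (Fin r) ℝ) : ℝ :=
  ‖(1 - Phat * Phatᵀ) * P‖

/-- Smallest eigenvalue of the diagonal matrix with diagonal `lam`. -/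
noncomputable def lamMin {r : ℕ} (lam : Fin r → ℝ) : ℝ := ⨅ j, lam j

/-- Largest eigenvalue of the diagonal matrix with diagonal `lam`. -/
noncomputable def lamMax {r : ℕ} (lam : Fin r → ℝ) : ℝ := ⨆ j, lam j

/-- Condition number of the diagonal matrix with diagonal `lam`. -/
noncomputable def condNumber {r : ℕ} (lam : Fin r → ℝ) : ℝ := lamMax lam / lamMin lam

/-- Covariance matrix of a random vector. -/
noncomputable def covMatrix {Ω : Type*} [MeasurableSpace Ω] {r : ℕ}
    (X : Ω → Fin r → ℝ) (μ : Measure Ω) : Matrix (Fin r) (Fin r) ℝ :=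
  Matrix.of fun i j => cov[fun ω => X ω i, fun ω => X ω j; μ]

/-- The subspace coefficients `a t` are mutually independent (over time) zero-mean random vectors
with common nonsingular covariance matrix `diagonal lam`, and are bounded:
`(a t)_j ^ 2 ≤ η * lam j` almost surely. -/
structure CoeffModel {Ω : Type*} [MeasurableSpace Ω] (μ : Measure Ω) {α r : ℕ}
    (a : Fin α → Ω → Fin r → ℝ) (lam : Fin r → ℝ) (η : ℝ) : Prop where
  measurable : ∀ t, Measurable (a t)
  indep : iIndepFun a μ
  zero_mean : ∀ t j, ∫ ω, a t ω j ∂μ = 0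
  cov_eq : ∀ t, covMatrix (a t) μ = Matrix.diagonal lam
  lam_pos : ∀ j, 0 < lam j
  bounded : ∀ t j, ∀ᵐ ω ∂μ, a t ω j ^ 2 ≤ η * lam j

/-- The data-dependency matrices `M t = M₂ t * M₁ t` (with an inner dimension `m t` that may vary
with time) satisfy `‖M₁ t * P‖ ≤ q < 1`, `‖M₂ t‖ ≤ 1` and, with parameter `β < α`,
the averaging inequality for every sequence of positive semidefinite matrices. -/
structure CorrelationModel {n r α : ℕ} (P : Matrix (Fin n) (Fin r) ℝ)
    (M : Fin α → Matrix (Fin n) (Fin n) ℝ) {m : Fin α → ℕ}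
    (M₂ : (t : Fin α) → Matrix (Fin n) (Fin (m t)) ℝ)
    (M₁ : (t : Fin α) → Matrix (Fin (m t)) (Fin n) ℝ) (q β : ℝ) : Prop where
  factor : ∀ t, M t = M₂ t * M₁ t
  norm_M₁ : ∀ t, ‖M₁ t * P‖ ≤ q
  q_lt_one : q < 1
  norm_M₂ : ∀ t, ‖M₂ t‖ ≤ 1
  beta_lt : β < α
  averaging : ∀ A : (t : Fin α) → Matrix (Fin (m t)) (Fin (m t)) ℝ,
    (∀ t, (A t).PosSemidef) →
      ‖(1 / (α : ℝ)) • ∑ t, M₂ t * A t * (M₂ t)ᵀ‖ ≤ β / α * ⨆ t, ‖A t‖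

/-- Empirical covariance matrix `(1/α) ∑ₜ yₜ yₜ'`. -/
noncomputable def empCov {n α : ℕ} (y : Fin α → Fin n → ℝ) : Matrix (Fin n) (Fin n) ℝ :=
  (1 / (α : ℝ)) • ∑ t, Matrix.vecMulVec (y t) (y t)

/-- `S = U diag(d) U'` with `U` orthogonal is an eigenvalue decomposition of `S`: column `j` of `U`
is a unit eigenvector with eigenvalue `d j`. -/
def IsEVD {n : ℕ} (S U : Matrix (Fin n) (Fin n) ℝ) (d : Fin n → ℝ) : Prop :=
  Uᵀ * U = 1 ∧ S = U * Matrix.diagonal d * Uᵀ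

/-- The matrix of those columns of `U` whose eigenvalue exceeds the threshold. -/
def keepAbove {n : ℕ} (U : Matrix (Fin n) (Fin n) ℝ) (d : Fin n → ℝ) (thresh : ℝ) :
    Matrix (Fin n) {j : Fin n // thresh < d j} ℝ :=
  U.submatrix id Subtype.val

/-- The lower bound `α₀` on the number of samples, with `C = 32 / 0.01²`. -/
noncomputable def sampleBound (n r : ℕ) (η q f ζ : ℝ) : ℝ :=
  32 / 0.01 ^ 2 * η ^ 2 * ((r : ℝ) ^ 2 * (11 * Real.log n) / ((r : ℝ) * ζ) ^ 2)
    * (max f (max (q * f) (q ^ 2 * f))) ^ 2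

/-- The upper bound on `β / α`. -/
noncomputable def betaBound (r : ℕ) (q f ζ : ℝ) : ℝ :=
  ((1 - r * ζ) / 2) ^ 2 *
    min ((r * ζ) ^ 2 / (4.1 * (q * f) ^ 2)) (r * ζ / (q ^ 2 * f))

/-! ### Hoeffding's inequality in a Hilbert space -/

section Concentration

open scoped RealInnerProductSpace

/-! Write the empirical covariance as `D = P Λ P' + W`, where `W` is bias plus fluctuation. The
theorem follows once `‖W‖ ≤ 0.8 rζ λ⁻` holds with high probability.

Bias: with `B t = P + M t * P` the mean of `D` exceeds `P Λ P'` by `N + N' + Q`, where `Q` averages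
`(M t P) Λ (M t P)'` and `N` averages `P Λ (M t P)'`. The averaging hypothesis bounds `Q`, and
Cauchy–Schwarz over time gives `‖N‖² ≤ λ⁺ ‖Q‖`. The two terms of the minimum in `betaBound` make `Q`
and `N` each at most `rζ λ⁻ / 4` (`CorrelationModel.l2_opNorm_bias_le`).

Fluctuation: the summands are independent bounded vectors for the Frobenius norm, which dominates
the operator norm and equals it on rank-one matrices. Pinelis' argument, `E cosh ‖S‖ ≤ (cosh b)^N`
for a sum `S` of `N` centred vectors bounded by `b`, gives a Hoeffding bound without a dimension
factor (`measureReal_norm_sum_ge_le`).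

Perturbation: an eigenvalue of `D` below the threshold is of the size of `W`, because its
eigenvector is nearly orthogonal to the range of `P`. A Sylvester equation then bounds the component
of `P` along the discarded eigenvectors (`subspaceError_keepAbove_le`). The number of kept
eigenvectors is never compared with `r`. -/

lemma ae_norm_sum_le {E Ω ι : Type*} [NormedAddCommGroup E] [MeasurableSpace Ω] {μ : Measure Ω}
    {X : ι → Ω → E} {b : ℝ} (hb : ∀ i, ∀ᵐ ω ∂μ, ‖X i ω‖ ≤ b) (s : Finset ι) :
    ∀ᵐ ω ∂μ, ‖(∑ i ∈ s, X i) ω‖ ≤ s.card * b := by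
  have h : ∀ᵐ ω ∂μ, ∀ i ∈ s, ‖X i ω‖ ≤ b :=
    (Finset.eventually_all s).2 fun i _ => hb i
  filter_upwards [h] with ω hω
  rw [Finset.sum_apply]
  simpa using norm_sum_le_of_le s hω

/-- Convexity of `z ↦ cosh √z`, evaluated between `(a - b)²` and `(a + b)²`. -/
lemma cosh_sqrt_le {a b w c : ℝ} (hw : |w| ≤ 1) (hc : c ^ 2 ≤ a ^ 2 + b ^ 2 + 2 * (a * b * w)) :
    Real.cosh c ≤ Real.cosh a * Real.cosh b + w * (Real.sinh a * Real.sinh b) := by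
  obtain ⟨hw1, hw2⟩ := abs_le.1 hw
  -- The bound on `c ^ 2` is the convex combination of `(a ± b) ^ 2` with weights `(1 ± w) / 2`.
  -- Convexity of `z ↦ z ^ k` compares the power series of `cosh` term by term.
  have key : ∀ k : ℕ, c ^ (2 * k) / ((2 * k).factorial : ℝ) ≤
      (1 + w) / 2 * ((a + b) ^ (2 * k) / ((2 * k).factorial : ℝ)) +
      (1 - w) / 2 * ((a - b) ^ (2 * k) / ((2 * k).factorial : ℝ)) := by
    intro k
    have h1 : (c ^ 2) ^ k ≤ ((1 + w) / 2 * (a + b) ^ 2 + (1 - w) / 2 * (a - b) ^ 2) ^ k :=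
      pow_le_pow_left₀ (sq_nonneg c) (hc.trans (le_of_eq (by ring))) k
    have h2 := (convexOn_pow (𝕜 := ℝ) k).2 (Set.mem_Ici.2 (sq_nonneg (a + b)))
      (Set.mem_Ici.2 (sq_nonneg (a - b))) (show 0 ≤ (1 + w) / 2 by linarith)
      (show 0 ≤ (1 - w) / 2 by linarith) (by ring)
    simp only [smul_eq_mul] at h2
    have h3 := h1.trans h2
    simp only [pow_mul]
    rw [← mul_div_assoc, ← mul_div_assoc, ← add_div]
    gcongr
  have h := hasSum_le key (Real.hasSum_cosh c)
    (((Real.hasSum_cosh (a + b)).mul_left _).add ((Real.hasSum_cosh (a - b)).mul_left _))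
  rw [Real.cosh_add, Real.cosh_sub] at h
  linarith

variable {E : Type*} [NormedAddCommGroup E] [InnerProductSpace ℝ E]

/-- The bound is affine in `v`, so its second term averages to zero when `v` is centred and
independent of `x`. It is `cosh_sqrt_le` with `w = ⟪x, v⟫ / (‖x‖ * b)`, since `‖v‖ ≤ b`. -/
lemma cosh_norm_add_le {b : ℝ} (hb : 0 < b) (x v : E) (hv : ‖v‖ ≤ b) :
    Real.cosh ‖x + v‖ ≤ Real.cosh ‖x‖ * Real.cosh b +
      Real.sinh b / b * ⟪(Real.sinh ‖x‖ / ‖x‖) • x, v⟫ := by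
  rcases eq_or_ne x 0 with rfl | hx
  · simpa [abs_of_nonneg hb.le] using hv
  have hx' : 0 < ‖x‖ := norm_pos_iff.2 hx
  have hin : |⟪x, v⟫| ≤ ‖x‖ * b :=
    (abs_real_inner_le_norm x v).trans (mul_le_mul_of_nonneg_left hv hx'.le)
  have h := cosh_sqrt_le (a := ‖x‖) (b := b) (w := ⟪x, v⟫ / (‖x‖ * b)) (c := ‖x + v‖)
    (by rw [abs_div, abs_of_pos (mul_pos hx' hb)]; exact (div_le_one (mul_pos hx' hb)).2 hin)
    (by
      rw [mul_div_cancel₀ _ (mul_pos hx' hb).ne', norm_add_sq_real]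
      nlinarith [norm_nonneg v])
  refine h.trans (le_of_eq ?_)
  rw [real_inner_smul_left]
  field_simp

variable [FiniteDimensional ℝ E] [MeasurableSpace E] [BorelSpace E]
variable {Ω : Type*} [MeasurableSpace Ω] {μ : Measure Ω} [IsProbabilityMeasure μ]
variable {ι : Type*} {X : ι → Ω → E}

lemma integrable_cosh_norm {Y : Ω → E} (hY : Measurable Y) {c : ℝ}
    (hc : ∀ᵐ ω ∂μ, ‖Y ω‖ ≤ c) : Integrable (fun ω => Real.cosh ‖Y ω‖) μ := by
  refine Integrable.of_bound (by fun_prop) (Real.cosh c) ?_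
  filter_upwards [hc] with ω hω
  rw [Real.norm_of_nonneg (Real.cosh_pos _).le, Real.cosh_le_cosh, abs_norm]
  exact hω.trans (le_abs_self c)

/-- Pinelis' bound on the hyperbolic moment of a sum of bounded independent centred vectors. -/
lemma integral_cosh_norm_sum_le {b : ℝ} (hb0 : 0 < b) (hm : ∀ i, Measurable (X i))
    (hind : iIndepFun X μ) (hmean : ∀ i, ∫ ω, X i ω ∂μ = 0)
    (hb : ∀ i, ∀ᵐ ω ∂μ, ‖X i ω‖ ≤ b) (s : Finset ι) :
    ∫ ω, Real.cosh ‖(∑ i ∈ s, X i) ω‖ ∂μ ≤ Real.cosh b ^ s.card := by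
  classical
  induction s using Finset.induction_on with
  | empty => simp
  | insert i s hi ih =>
    set S : Ω → E := ∑ j ∈ s, X j with hS
    have hSm : Measurable S := by
      simpa only [hS, ← Finset.sum_apply] using Finset.measurable_sum s fun j _ => hm j
    have hSb := ae_norm_sum_le hb s
    have hI : Integrable (fun ω => Real.cosh ‖S ω‖) μ := integrable_cosh_norm hSm hSb
    -- `F` is the gradient of `cosh ‖x‖`. As `F (S ω)` depends only on the earlier summands, its
    -- inner product with the centred `X i` has mean zero.
    set F : E → E := fun x => (Real.sinh ‖x‖ / ‖x‖) • x with hF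
    have hFm : Measurable F := by fun_prop
    have hFb : ∀ x, ‖F x‖ ≤ Real.cosh ‖x‖ := by
      intro x
      rcases eq_or_ne x 0 with rfl | hx
      · simp [hF]
      · have hx' : 0 < ‖x‖ := norm_pos_iff.2 hx
        have hs : 0 ≤ Real.sinh ‖x‖ := Real.sinh_nonneg_iff.2 hx'.le
        rw [hF, norm_smul, Real.norm_of_nonneg (div_nonneg hs hx'.le), div_mul_cancel₀ _ hx'.ne']
        exact (Real.sinh_lt_cosh _).le
    have hFI : Integrable (fun ω => F (S ω)) μ :=
      hI.mono' (hFm.comp hSm).aestronglyMeasurable (ae_of_all _ fun ω => hFb (S ω))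
    have hXI : Integrable (X i) μ := Integrable.of_bound (hm i).aestronglyMeasurable b (hb i)
    have hSX : IndepFun S (X i) μ := hind.indepFun_finsetSum_of_notMem hm hi
    have hFX : IndepFun (fun ω => F (S ω)) (X i) μ := hSX.comp hFm measurable_id
    have hcross : ∫ ω, ⟪F (S ω), X i ω⟫ ∂μ = 0 := by
      have := hFX.integral_bilin hFI hXI (innerSL ℝ)
      rw [hmean i, map_zero] at this
      exact this
    have hcrossI : Integrable (fun ω => ⟪F (S ω), X i ω⟫) μ :=
      hFX.integrable_bilin hFI hXI (innerSL ℝ)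
    have hsum : ∑ j ∈ insert i s, X j = fun ω => S ω + X i ω := by
      rw [Finset.sum_insert hi, add_comm]; rfl
    calc ∫ ω, Real.cosh ‖(∑ j ∈ insert i s, X j) ω‖ ∂μ
        ≤ ∫ ω, (Real.cosh ‖S ω‖ * Real.cosh b + Real.sinh b / b * ⟪F (S ω), X i ω⟫) ∂μ := by
          refine integral_mono_ae ?_ ((hI.mul_const _).add (hcrossI.const_mul _)) ?_
          · exact integrable_cosh_norm (by rw [hsum]; exact hSm.add (hm i))
              (ae_norm_sum_le hb _)
          · filter_upwards [hb i] with ω hω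
            rw [hsum]
            exact cosh_norm_add_le hb0 (S ω) (X i ω) hω
      _ = (∫ ω, Real.cosh ‖S ω‖ ∂μ) * Real.cosh b := by
          rw [integral_add (hI.mul_const _) (hcrossI.const_mul _), integral_mul_const,
            integral_const_mul, hcross, mul_zero, add_zero]
      _ ≤ Real.cosh b ^ s.card * Real.cosh b := by
          gcongr
      _ = Real.cosh b ^ (insert i s).card := by
          rw [Finset.card_insert_of_notMem hi, pow_succ]

/-- Hoeffding's inequality in a finite-dimensional Hilbert space, with dimension-free constants. -/
theorem measureReal_norm_sum_ge_le [Fintype ι] {b τ : ℝ} (hb0 : 0 < b) (hτ : 0 < τ)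
    (hm : ∀ i, Measurable (X i)) (hind : iIndepFun X μ) (hmean : ∀ i, ∫ ω, X i ω ∂μ = 0)
    (hb : ∀ i, ∀ᵐ ω ∂μ, ‖X i ω‖ ≤ b) (hι : 0 < Fintype.card ι) :
    μ.real {ω | τ ≤ ‖∑ i, X i ω‖} ≤
      2 * Real.exp (-(τ ^ 2 / (2 * Fintype.card ι * b ^ 2))) := by
  set N : ℝ := (Fintype.card ι : ℝ) with hN
  have hN0 : 0 < N := by rw [hN]; exact_mod_cast hι
  -- This `θ` minimises the exponent `N * (θ * b) ^ 2 / 2 - θ * τ`.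
  set θ : ℝ := τ / (N * b ^ 2) with hθ
  have hθ0 : 0 < θ := by positivity
  have hscal := integral_cosh_norm_sum_le (μ := μ) (X := fun i ω => θ • X i ω) (b := θ * b)
    (by positivity) (fun i => (hm i).const_smul θ)
    (hind.comp (fun _ x => θ • x) fun _ => measurable_const_smul θ)
    (fun i => by rw [integral_smul, hmean i, smul_zero])
    (fun i => by
      filter_upwards [hb i] with ω hω
      rw [norm_smul, Real.norm_of_nonneg hθ0.le]
      gcongr) Finset.univ
  have hform : ∀ ω, ‖(∑ i, fun ω => θ • X i ω) ω‖ = θ * ‖∑ i, X i ω‖ := by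
    intro ω
    rw [Finset.sum_apply, ← Finset.smul_sum, norm_smul, Real.norm_of_nonneg hθ0.le]
  simp only [hform, Finset.card_univ] at hscal
  have hSm : Measurable fun ω => ∑ i, X i ω := Finset.measurable_fun_sum _ fun i _ => hm i
  have hInt : Integrable (fun ω => Real.cosh (θ * ‖∑ i, X i ω‖)) μ := by
    have hb' := ae_norm_sum_le hb Finset.univ
    have := integrable_cosh_norm (μ := μ) (Y := fun ω => θ • ∑ i, X i ω)
      (c := θ * ((Finset.univ : Finset ι).card * b)) (hSm.const_smul θ) (by
        filter_upwards [hb'] with ω hω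
        rw [norm_smul, Real.norm_of_nonneg hθ0.le]
        rw [Finset.sum_apply] at hω
        gcongr)
    simpa only [norm_smul, Real.norm_of_nonneg hθ0.le] using this
  have hmarkov := mul_meas_ge_le_integral_of_nonneg
    (ae_of_all μ fun ω => (Real.cosh_pos (θ * ‖∑ i, X i ω‖)).le) hInt (Real.cosh (θ * τ))
  have hset : {ω | τ ≤ ‖∑ i, X i ω‖} =
      {ω | Real.cosh (θ * τ) ≤ Real.cosh (θ * ‖∑ i, X i ω‖)} := by
    ext ω
    simp only [Set.mem_ofPred_eq, Real.cosh_le_cosh]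
    rw [abs_of_pos (by positivity), abs_of_nonneg (by positivity), mul_le_mul_iff_right₀ hθ0]
  rw [hset]
  set p := μ.real {ω | Real.cosh (θ * τ) ≤ Real.cosh (θ * ‖∑ i, X i ω‖)} with hp
  have hp0 : 0 ≤ p := measureReal_nonneg
  have h1 : Real.cosh (θ * τ) * p ≤ Real.exp (N * ((θ * b) ^ 2 / 2)) := by
    refine (hmarkov.trans hscal).trans ?_
    rw [Real.exp_nat_mul]
    exact pow_le_pow_left₀ (Real.cosh_pos _).le (Real.cosh_le_exp_half_sq _) _
  have h2 : Real.exp (θ * τ) / 2 ≤ Real.cosh (θ * τ) := by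
    rw [Real.cosh_eq]
    have := Real.exp_pos (-(θ * τ))
    linarith
  have h3 : Real.exp (θ * τ) * p ≤ 2 * Real.exp (N * ((θ * b) ^ 2 / 2)) := by
    nlinarith [mul_le_mul_of_nonneg_right h2 hp0]
  have h4 : p ≤ 2 * Real.exp (N * ((θ * b) ^ 2 / 2)) / Real.exp (θ * τ) := by
    rw [le_div_iff₀ (Real.exp_pos _), mul_comm]; exact h3
  refine h4.trans (le_of_eq ?_)
  rw [mul_div_assoc, ← Real.exp_sub]
  congr 2
  rw [hθ]
  field_simp
  ring

end Concentration

/-! ### Operator norms through quadratic forms -/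

section OperatorNorm

variable {m n k : Type*} [Fintype m] [Fintype n] [Fintype k] [DecidableEq n]

lemma norm_toLp_sq (x : m → ℝ) : ‖WithLp.toLp 2 x‖ ^ 2 = x ⬝ᵥ x := by
  rw [EuclideanSpace.real_norm_sq_eq]
  simp only [dotProduct, sq]

lemma dotProduct_self_nonneg_real (x : m → ℝ) : 0 ≤ x ⬝ᵥ x :=
  norm_toLp_sq x ▸ sq_nonneg _

lemma mulVec_dotProduct_mulVec_le (A : Matrix m n ℝ) (x : n → ℝ) :
    (A *ᵥ x) ⬝ᵥ (A *ᵥ x) ≤ ‖A‖ ^ 2 * (x ⬝ᵥ x) := by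
  have h := A.l2_opNorm_mulVec (WithLp.toLp 2 x)
  have h2 := pow_le_pow_left₀ (norm_nonneg _) h 2
  rw [mul_pow, norm_toLp_sq x] at h2
  rw [← norm_toLp_sq (A *ᵥ x)]
  exact h2

lemma l2_opNorm_sq_le_of_forall (A : Matrix m n ℝ) {c : ℝ} (hc : 0 ≤ c)
    (h : ∀ x : n → ℝ, (A *ᵥ x) ⬝ᵥ (A *ᵥ x) ≤ c * (x ⬝ᵥ x)) : ‖A‖ ^ 2 ≤ c := by
  have h1 : ‖A‖ ≤ √c := by
    rw [Matrix.l2_opNorm_def]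
    refine ContinuousLinearMap.opNorm_le_bound _ (Real.sqrt_nonneg c) fun x => ?_
    refine le_of_sq_le_sq ?_ (by positivity)
    rw [mul_pow, Real.sq_sqrt hc]
    have := h x.ofLp
    rw [← norm_toLp_sq, ← norm_toLp_sq] at this
    exact this
  calc ‖A‖ ^ 2 ≤ √c ^ 2 := pow_le_pow_left₀ (norm_nonneg _) h1 2
    _ = c := Real.sq_sqrt hc

lemma dotProduct_sq_le (x y : m → ℝ) : (x ⬝ᵥ y) ^ 2 ≤ (x ⬝ᵥ x) * (y ⬝ᵥ y) := by
  have := Finset.sum_mul_sq_le_sq_mul_sq Finset.univ x y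
  simpa only [dotProduct, sq] using this

lemma dotProduct_mulVec_self_le (A : Matrix n n ℝ) (x : n → ℝ) :
    x ⬝ᵥ (A *ᵥ x) ≤ ‖A‖ * (x ⬝ᵥ x) := by
  refine le_of_sq_le_sq ?_ (mul_nonneg (norm_nonneg _) (dotProduct_self_nonneg_real x))
  have h1 := dotProduct_sq_le x (A *ᵥ x)
  have h2 := mul_le_mul_of_nonneg_left (mulVec_dotProduct_mulVec_le A x)
    (dotProduct_self_nonneg_real x)
  linarith [h1.trans h2]

/-- Cauchy–Schwarz in each row. This moves the concentration of matrices into a Euclidean space. -/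
lemma l2_opNorm_le_frobenius (A : Matrix m n ℝ) :
    ‖A‖ ≤ ‖(WithLp.toLp 2 fun p : m × n => A p.1 p.2 : EuclideanSpace ℝ (m × n))‖ := by
  refine le_of_sq_le_sq ?_ (norm_nonneg _)
  refine l2_opNorm_sq_le_of_forall A (sq_nonneg _) fun x => ?_
  have h : (fun p : m × n => A p.1 p.2) ⬝ᵥ (fun p : m × n => A p.1 p.2) = ∑ i, A i ⬝ᵥ A i := by
    simp only [dotProduct, Fintype.sum_prod_type]
  rw [norm_toLp_sq, h, dotProduct, Finset.sum_mul]
  refine Finset.sum_le_sum fun i _ => ?_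
  have := dotProduct_sq_le (A i) x
  rw [← sq]
  exact this

lemma l2_opNorm_transpose [DecidableEq m] (A : Matrix m n ℝ) : ‖Aᵀ‖ = ‖A‖ := by
  rw [← Matrix.conjTranspose_eq_transpose_of_trivial, Matrix.l2_opNorm_conjTranspose]

lemma l2_opNorm_diagonal_le {v : n → ℝ} {c : ℝ} (hc : 0 ≤ c) (h : ∀ i, |v i| ≤ c) :
    ‖Matrix.diagonal v‖ ≤ c := by
  rw [Matrix.l2_opNorm_diagonal]
  exact (pi_norm_le_iff_of_nonneg hc).2 h

lemma l2_opNorm_le_one_of_transpose_mul_self {A : Matrix m n ℝ} (h : Aᵀ * A = 1) :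
    ‖A‖ ≤ 1 := by
  have h1 : ‖(1 : Matrix n n ℝ)‖ ≤ 1 := by
    rw [← Matrix.diagonal_one]
    exact l2_opNorm_diagonal_le zero_le_one fun _ => by simp
  have h2 := Matrix.l2_opNorm_conjTranspose_mul_self A
  rw [Matrix.conjTranspose_eq_transpose_of_trivial, h] at h2
  nlinarith [norm_nonneg A]

lemma mulVec_dotProduct_mulVec_of_transpose_mul_self {A : Matrix m n ℝ} (h : Aᵀ * A = 1)
    (x : n → ℝ) : (A *ᵥ x) ⬝ᵥ (A *ᵥ x) = x ⬝ᵥ x := by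
  rw [Matrix.dotProduct_mulVec, Matrix.vecMul_mulVec, ← Matrix.dotProduct_mulVec, h,
    Matrix.one_mulVec]

/-- The orthogonal projection onto the complement of the columns of `A` is a contraction. -/
lemma dotProduct_sub_projection {A : Matrix m n ℝ} (h : Aᵀ * A = 1) (x : m → ℝ) :
    (x - A *ᵥ (Aᵀ *ᵥ x)) ⬝ᵥ (x - A *ᵥ (Aᵀ *ᵥ x)) = x ⬝ᵥ x - (Aᵀ *ᵥ x) ⬝ᵥ (Aᵀ *ᵥ x) := by
  have h1 : x ⬝ᵥ (A *ᵥ (Aᵀ *ᵥ x)) = (Aᵀ *ᵥ x) ⬝ᵥ (Aᵀ *ᵥ x) := by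
    rw [Matrix.dotProduct_mulVec, ← Matrix.mulVec_transpose]
  have h2 := mulVec_dotProduct_mulVec_of_transpose_mul_self h (Aᵀ *ᵥ x)
  rw [sub_dotProduct, dotProduct_sub, dotProduct_sub, h2, dotProduct_comm (A *ᵥ _) x, h1]
  ring

end OperatorNorm

/-! ### Perturbation of the thresholded eigenspace -/

section SinTheta

variable {n r : ℕ}

lemma keepAbove_mul_transpose (U : Matrix (Fin n) (Fin n) ℝ) (d : Fin n → ℝ) (c : ℝ) :
    keepAbove U d c * (keepAbove U d c)ᵀ =
      U * Matrix.diagonal (fun j => if c < d j then 1 else 0) * Uᵀ := by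
  ext i k
  rw [Matrix.mul_apply, Matrix.mul_apply]
  simp only [Matrix.mul_diagonal, Matrix.transpose_apply, keepAbove, Matrix.submatrix_apply, id]
  rw [← Finset.sum_subtype (Finset.univ.filter fun j => c < d j) (by simp)
    (fun j => U i j * U k j), Finset.sum_filter]
  refine Finset.sum_congr rfl fun j _ => ?_
  split_ifs <;> simp

/-- A perturbed eigenvalue below the gap is at most as large as the perturbation, up to a factor. -/
lemma abs_eigenvalue_le {P : Matrix (Fin n) (Fin r) ℝ} (hP : Pᵀ * P = 1) {lam : Fin r → ℝ}
    {W : Matrix (Fin n) (Fin n) ℝ} {l δ d : ℝ} (hl : 0 < l) (hlam : ∀ j, l ≤ lam j)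
    (hW : ‖W‖ ≤ δ) (hδ : δ ≤ 0.008 * l) {u : Fin n → ℝ} (hu : u ⬝ᵥ u = 1)
    (hd : d ≤ 0.95 * l)
    (heig : (P * Matrix.diagonal lam * Pᵀ + W) *ᵥ u = d • u) : |d| ≤ 1.02 * δ := by
  have hδ0 : 0 ≤ δ := (norm_nonneg _).trans hW
  set p := Pᵀ *ᵥ u with hp
  set w := W *ᵥ u with hw
  have heq : P *ᵥ (Matrix.diagonal lam *ᵥ p) + w = d • u := by
    rw [← heig, Matrix.add_mulVec, hp, hw, Matrix.mulVec_mulVec, Matrix.mulVec_mulVec,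
      Matrix.mul_assoc]
  have hw2 : w ⬝ᵥ w ≤ δ ^ 2 := by
    have h1 := mulVec_dotProduct_mulVec_le W u
    rw [hu, mul_one] at h1
    exact h1.trans (pow_le_pow_left₀ (norm_nonneg _) hW 2)
  have hproj := dotProduct_sub_projection hP w
  have hPw : (Pᵀ *ᵥ w) ⬝ᵥ (Pᵀ *ᵥ w) ≤ δ ^ 2 := by
    have := dotProduct_self_nonneg_real (w - P *ᵥ (Pᵀ *ᵥ w))
    linarith
  have heqP : Matrix.diagonal lam *ᵥ p + Pᵀ *ᵥ w = d • p := by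
    have := congrArg (Pᵀ *ᵥ ·) heq
    simpa [Matrix.mulVec_add, Matrix.mulVec_mulVec, ← Matrix.mul_assoc, hP, Matrix.mulVec_smul]
      using this
  -- In coordinates `heqP` reads `(d - lam j) * p j = (Pᵀ *ᵥ w) j`, and `lam j - d ≥ 0.05 * l` by
  -- the threshold.
  have hpp : (0.05 * l) ^ 2 * (p ⬝ᵥ p) ≤ δ ^ 2 := by
    refine le_trans ?_ hPw
    rw [dotProduct, dotProduct, Finset.mul_sum]
    refine Finset.sum_le_sum fun j _ => ?_
    have hj := congrFun heqP j
    simp only [Pi.add_apply, Matrix.mulVec_diagonal, Pi.smul_apply, smul_eq_mul] at hj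
    have hj' : (Pᵀ *ᵥ w) j = (d - lam j) * p j := by linarith
    rw [hj']
    have h1 : (0.05 * l) ^ 2 ≤ (d - lam j) ^ 2 := by
      have := hlam j
      nlinarith
    nlinarith [mul_le_mul_of_nonneg_right h1 (mul_self_nonneg (p j))]
  -- `(0.008 / 0.05) ^ 2 = 0.0256`.
  have hsmall : p ⬝ᵥ p ≤ 0.0256 := by
    have h1 : δ ^ 2 ≤ (0.008 * l) ^ 2 := pow_le_pow_left₀ hδ0 hδ 2
    have h2 : 0 < l ^ 2 := by positivity
    by_contra hcon
    push Not at hcon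
    nlinarith [mul_lt_mul_of_pos_right hcon h2]
  -- Off the range of `P` the matrix `P Λ P'` contributes nothing, so there `d` acts against `w`
  -- alone. As `u` lies mostly there, `|d|` is at most about `δ`.
  have hres : d • (u - P *ᵥ p) = w - P *ᵥ (Pᵀ *ᵥ w) := by
    have h1 : P *ᵥ (Pᵀ *ᵥ w) = d • (P *ᵥ p) - P *ᵥ (Matrix.diagonal lam *ᵥ p) := by
      rw [← Matrix.mulVec_smul, ← heqP, Matrix.mulVec_add]; abel
    rw [h1, smul_sub, ← heq]; abel
  have hd2 : d ^ 2 * (1 - p ⬝ᵥ p) ≤ δ ^ 2 := by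
    have h1 := dotProduct_sub_projection hP u
    rw [hu, ← hp] at h1
    have h2 : (d • (u - P *ᵥ p)) ⬝ᵥ (d • (u - P *ᵥ p)) = d ^ 2 * (1 - p ⬝ᵥ p) := by
      rw [smul_dotProduct, dotProduct_smul, h1, smul_eq_mul, smul_eq_mul]; ring
    rw [← h2, hres, hproj]
    have := dotProduct_self_nonneg_real (Pᵀ *ᵥ w)
    linarith
  refine abs_le_of_sq_le_sq ?_ (by positivity)
  nlinarith [sq_nonneg d, sq_nonneg δ]

/-- A `sin θ` theorem for eigenvectors selected by thresholding the eigenvalues. -/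
theorem subspaceError_keepAbove_le {P : Matrix (Fin n) (Fin r) ℝ} (hP : IsBasisMatrix P)
    {lam : Fin r → ℝ} {D W U : Matrix (Fin n) (Fin n) ℝ} {d : Fin n → ℝ} {l ε : ℝ}
    (hl : 0 < l) (hlam : ∀ j, l ≤ lam j) (hε : 0 < ε) (hε1 : ε ≤ 0.01)
    (hD : D = P * Matrix.diagonal lam * Pᵀ + W) (hW : ‖W‖ ≤ 0.8 * ε * l) (hU : IsEVD D U d) :
    subspaceError (keepAbove U d (0.95 * l)) P ≤ ε := by
  obtain ⟨hUU, hDU⟩ := hU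
  have hP' : Pᵀ * P = 1 := hP
  have hUU' : U * Uᵀ = 1 := mul_eq_one_comm.1 hUU
  have hUDU : Uᵀ * D = Matrix.diagonal d * Uᵀ := by
    rw [hDU, ← Matrix.mul_assoc, ← Matrix.mul_assoc, hUU, Matrix.one_mul]
  set δ : ℝ := 0.8 * ε * l with hδ
  have hδ0 : 0 ≤ δ := by positivity
  have hδl : δ ≤ 0.008 * l := by nlinarith
  -- `κ` marks the discarded eigenvectors, and `X` holds the coordinates of `P` along them.
  set κ : Fin n → ℝ := fun j => if 0.95 * l < d j then 0 else 1 with hκ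
  set X : Matrix (Fin n) (Fin r) ℝ := Matrix.diagonal κ * Uᵀ * P with hX
  have hdis : ∀ j, |κ j * d j| ≤ 1.02 * δ := by
    intro j
    simp only [hκ]
    split_ifs with h
    · rw [zero_mul, abs_zero]
      positivity
    rw [one_mul]
    refine abs_eigenvalue_le (u := fun i => U i j) hP' hl hlam hW hδl ?_ (not_lt.1 h) ?_
    · have := congrFun (congrFun hUU j) j
      simpa [Matrix.mul_apply, dotProduct] using this
    · rw [← hD]
      have hDU' : D * U = U * Matrix.diagonal d := by
        rw [hDU, Matrix.mul_assoc, hUU, Matrix.mul_one]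
      ext i
      have := congrFun (congrFun hDU' i) j
      rw [Matrix.mul_diagonal] at this
      rw [Pi.smul_apply, smul_eq_mul, mul_comm, ← this]
      rfl
  have hnU : ‖Uᵀ‖ ≤ 1 := by
    rw [l2_opNorm_transpose]; exact l2_opNorm_le_one_of_transpose_mul_self hUU
  have hnκ : ‖Matrix.diagonal κ‖ ≤ 1 := by
    refine l2_opNorm_diagonal_le zero_le_one fun j => ?_
    simp only [hκ]
    split_ifs <;> simp
  -- A Sylvester equation: `Λ ≥ l` on one side and discarded eigenvalues of size at most `1.02 * δ`
  -- on the other, so `‖X‖` is of order `δ / l`.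
  have hsylv : X * Matrix.diagonal lam =
      Matrix.diagonal (fun j => κ j * d j) * X - Matrix.diagonal κ * Uᵀ * (W * P) := by
    have h1 : D * P = P * Matrix.diagonal lam + W * P := by
      rw [hD, Matrix.add_mul, Matrix.mul_assoc, hP', Matrix.mul_one]
    have hcomm : Matrix.diagonal κ * Matrix.diagonal d =
        Matrix.diagonal (fun j => κ j * d j) * Matrix.diagonal κ := by
      rw [Matrix.diagonal_mul_diagonal, Matrix.diagonal_mul_diagonal]
      congr 1
      ext j
      simp only [hκ]
      split_ifs <;> simp
    have h2 : Matrix.diagonal κ * Uᵀ * (D * P) = Matrix.diagonal (fun j => κ j * d j) * X := by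
      rw [hX, ← Matrix.mul_assoc, Matrix.mul_assoc (Matrix.diagonal κ), hUDU,
        ← Matrix.mul_assoc, hcomm]
      simp only [Matrix.mul_assoc]
    rw [← h2, h1, Matrix.mul_add, hX]
    simp only [Matrix.mul_assoc]
    abel
  have hinv : X * Matrix.diagonal lam * Matrix.diagonal (fun j => (lam j)⁻¹) = X := by
    rw [Matrix.mul_assoc, Matrix.diagonal_mul_diagonal]
    have : (fun j => lam j * (lam j)⁻¹) = fun _ => 1 := by
      ext j; exact mul_inv_cancel₀ (hl.trans_le (hlam j)).ne'
    rw [this, Matrix.diagonal_one, Matrix.mul_one]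
  have hXn : ‖X‖ * l ≤ 1.02 * δ * ‖X‖ + δ := by
    have h1 : ‖X * Matrix.diagonal lam‖ ≤ 1.02 * δ * ‖X‖ + δ := by
      rw [hsylv]
      refine (norm_sub_le _ _).trans (add_le_add ?_ ?_)
      · refine (Matrix.l2_opNorm_mul _ _).trans ?_
        gcongr
        exact l2_opNorm_diagonal_le (by positivity) hdis
      · calc ‖Matrix.diagonal κ * Uᵀ * (W * P)‖
            ≤ (‖Matrix.diagonal κ‖ * ‖Uᵀ‖) * (‖W‖ * ‖P‖) :=
              (Matrix.l2_opNorm_mul _ _).trans (mul_le_mul (Matrix.l2_opNorm_mul _ _)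
                (Matrix.l2_opNorm_mul _ _) (norm_nonneg _) (by positivity))
          _ ≤ (1 * 1) * (δ * 1) := by
              gcongr
              exact l2_opNorm_le_one_of_transpose_mul_self hP'
          _ = δ := by ring
    have h2 : ‖X‖ ≤ ‖X * Matrix.diagonal lam‖ * l⁻¹ := by
      conv_lhs => rw [← hinv]
      refine (Matrix.l2_opNorm_mul _ _).trans ?_
      gcongr
      refine l2_opNorm_diagonal_le (by positivity) fun j => ?_
      have := hl.trans_le (hlam j)
      rw [abs_of_pos (by positivity)]
      exact inv_anti₀ hl (hlam j)
    calc ‖X‖ * l ≤ ‖X * Matrix.diagonal lam‖ * l⁻¹ * l := by gcongr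
      _ = ‖X * Matrix.diagonal lam‖ := by field_simp
      _ ≤ _ := h1
  have hXε : ‖X‖ ≤ ε := by
    have h1 : ‖X‖ * δ ≤ ‖X‖ * (0.008 * l) := by gcongr
    -- The factor `0.9` lies between `0.8` and `1 - 1.02 * 0.008`.
    have h2 : ‖X‖ * (0.9 * l) ≤ ε * (0.9 * l) := by
      nlinarith [mul_pos hε hl, mul_nonneg (norm_nonneg X) hl.le]
    exact le_of_mul_le_mul_right h2 (by positivity)
  have hres : (1 - keepAbove U d (0.95 * l) * (keepAbove U d (0.95 * l))ᵀ) * P = U * X := by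
    rw [keepAbove_mul_transpose, hX, ← Matrix.mul_assoc]
    congr 1
    have : Matrix.diagonal κ = 1 - Matrix.diagonal (fun j => if 0.95 * l < d j then (1 : ℝ) else 0) := by
      rw [← Matrix.diagonal_one, Matrix.diagonal_sub]
      congr 1
      ext j
      simp only [hκ]
      split_ifs <;> simp
    rw [this, Matrix.sub_mul, Matrix.one_mul, Matrix.mul_sub, hUU', Matrix.mul_assoc]
  rw [subspaceError, hres]
  calc ‖U * X‖ ≤ ‖U‖ * ‖X‖ := Matrix.l2_opNorm_mul _ _
    _ ≤ 1 * ‖X‖ := by gcongr; exact l2_opNorm_le_one_of_transpose_mul_self hUU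
    _ ≤ ε := by rwa [one_mul]

end SinTheta

/-! ### Cauchy–Schwarz for the cross term -/

section Bias

variable {n r α : ℕ}

/-- The cross term of the averaged covariance is controlled by the noise term. -/
lemma l2_opNorm_cross_sq_le (hα : 0 < α) {P : Matrix (Fin n) (Fin r) ℝ} (hP : Pᵀ * P = 1)
    {lam : Fin r → ℝ} {L : ℝ} (hlam0 : ∀ j, 0 ≤ lam j) (hlam : ∀ j, lam j ≤ L) (hL : 0 ≤ L)
    (C : Fin α → Matrix (Fin n) (Fin r) ℝ) :
    ‖(1 / (α : ℝ)) • ∑ t, P * Matrix.diagonal lam * (C t)ᵀ‖ ^ 2 ≤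
      L * ‖(1 / (α : ℝ)) • ∑ t, C t * Matrix.diagonal lam * (C t)ᵀ‖ := by
  have hα' : (0 : ℝ) < α := by exact_mod_cast hα
  set Q := (1 / (α : ℝ)) • ∑ t, C t * Matrix.diagonal lam * (C t)ᵀ with hQ
  refine l2_opNorm_sq_le_of_forall _ (by positivity) fun u => ?_
  set c : Fin α → Fin r → ℝ := fun t => (C t)ᵀ *ᵥ u with hc
  have h1 : ((1 / (α : ℝ)) • ∑ t, P * Matrix.diagonal lam * (C t)ᵀ) *ᵥ u =
      P *ᵥ ((1 / (α : ℝ)) • ∑ t, fun j => lam j * c t j) := by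
    rw [Matrix.smul_mulVec, Matrix.mulVec_smul, Matrix.sum_mulVec, Matrix.mulVec_sum]
    congr 1
    refine Finset.sum_congr rfl fun t _ => ?_
    rw [← Matrix.mulVec_mulVec, ← Matrix.mulVec_mulVec]
    congr 1
    ext j
    rw [Matrix.mulVec_diagonal]
  have h2 : u ⬝ᵥ (Q *ᵥ u) = (1 / (α : ℝ)) * ∑ t, ∑ j, lam j * c t j ^ 2 := by
    rw [hQ, Matrix.smul_mulVec, dotProduct_smul, Matrix.sum_mulVec, dotProduct_sum, smul_eq_mul]
    congr 1
    refine Finset.sum_congr rfl fun t _ => ?_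
    rw [← Matrix.mulVec_mulVec, ← Matrix.mulVec_mulVec, Matrix.dotProduct_mulVec,
      ← Matrix.mulVec_transpose, dotProduct]
    refine Finset.sum_congr rfl fun j _ => ?_
    rw [Matrix.mulVec_diagonal]
    simp only [hc]
    ring
  rw [h1, mulVec_dotProduct_mulVec_of_transpose_mul_self hP]
  have h3 : ((1 / (α : ℝ)) • ∑ t, fun j => lam j * c t j) ⬝ᵥ
      ((1 / (α : ℝ)) • ∑ t, fun j => lam j * c t j) ≤ L * (u ⬝ᵥ (Q *ᵥ u)) := by
    rw [h2, Finset.sum_comm, dotProduct, Finset.mul_sum, Finset.mul_sum]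
    refine Finset.sum_le_sum fun j _ => ?_
    simp only [Pi.smul_apply, Finset.sum_apply, smul_eq_mul]
    -- Cauchy–Schwarz over time costs a factor `α`, which one of the two factors `1 / α` absorbs.
    -- Next, one of the two factors `lam j` is bounded by `L`.
    have hcs : (∑ t, lam j * c t j) ^ 2 ≤ α * ∑ t, (lam j * c t j) ^ 2 := by
      simpa using sq_sum_le_card_mul_sum_sq (s := Finset.univ) (f := fun t => lam j * c t j)
    have hle : ∑ t, (lam j * c t j) ^ 2 ≤ L * ∑ t, lam j * c t j ^ 2 := by
      rw [Finset.mul_sum]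
      refine Finset.sum_le_sum fun t _ => ?_
      have := mul_le_mul_of_nonneg_right (hlam j) (mul_nonneg (hlam0 j) (sq_nonneg (c t j)))
      nlinarith
    calc (1 / (α : ℝ) * ∑ t, lam j * c t j) * (1 / (α : ℝ) * ∑ t, lam j * c t j)
        = (1 / (α : ℝ)) ^ 2 * (∑ t, lam j * c t j) ^ 2 := by ring
      _ ≤ (1 / (α : ℝ)) ^ 2 * (α * (L * ∑ t, lam j * c t j ^ 2)) := by gcongr; nlinarith
      _ = L * (1 / (α : ℝ) * ∑ t, lam j * c t j ^ 2) := by field_simp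
  refine h3.trans ?_
  rw [mul_assoc]
  exact mul_le_mul_of_nonneg_left (dotProduct_mulVec_self_le Q u) hL

end Bias

/-! ### Bias of the mean covariance -/

section Model

variable {n r α : ℕ} {lam : Fin r → ℝ}

lemma lamMin_le (j : Fin r) : lamMin lam ≤ lam j :=
  ciInf_le (Set.finite_range lam).bddBelow j

lemma le_lamMax (j : Fin r) : lam j ≤ lamMax lam :=
  le_ciSup (Set.finite_range lam).bddAbove j

lemma lamMin_pos (hr : 0 < r) (h : ∀ j, 0 < lam j) : 0 < lamMin lam := by
  have : Nonempty (Fin r) := ⟨⟨0, hr⟩⟩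
  obtain ⟨j, hj⟩ := exists_eq_ciInf_of_finite (f := lam)
  rw [lamMin, ← hj]
  exact h j

/-- The averaging hypothesis is applied to `A t = (M₁ t P) Λ (M₁ t P)'`. Since `β` may be negative,
the maximum with `0` is needed before the supremum is replaced by its upper bound. -/
lemma CorrelationModel.l2_opNorm_noise_le {P : Matrix (Fin n) (Fin r) ℝ}
    {M : Fin α → Matrix (Fin n) (Fin n) ℝ} {m : Fin α → ℕ}
    {M₂ : (t : Fin α) → Matrix (Fin n) (Fin (m t)) ℝ}
    {M₁ : (t : Fin α) → Matrix (Fin (m t)) (Fin n) ℝ} {q β : ℝ}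
    (h : CorrelationModel P M M₂ M₁ q β) (hα : 0 < α) {L : ℝ} (hlam0 : ∀ j, 0 ≤ lam j)
    (hlam : ∀ j, lam j ≤ L) (hL : 0 ≤ L) :
    ‖(1 / (α : ℝ)) • ∑ t, (M t * P) * Matrix.diagonal lam * (M t * P)ᵀ‖ ≤
      max (β / α) 0 * (q ^ 2 * L) := by
  have : Nonempty (Fin α) := ⟨⟨0, hα⟩⟩
  have hA : ∀ t, ((M₁ t * P) * Matrix.diagonal lam * (M₁ t * P)ᵀ).PosSemidef := fun t => by
    have := (Matrix.PosSemidef.diagonal (d := lam) hlam0).mul_mul_conjTranspose_same (M₁ t * P)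
    rwa [Matrix.conjTranspose_eq_transpose_of_trivial] at this
  have havg := h.averaging _ hA
  have heq : ∀ t, M₂ t * ((M₁ t * P) * Matrix.diagonal lam * (M₁ t * P)ᵀ) * (M₂ t)ᵀ =
      (M t * P) * Matrix.diagonal lam * (M t * P)ᵀ := fun t => by
    rw [h.factor t]
    simp only [Matrix.transpose_mul, Matrix.mul_assoc]
  simp only [heq] at havg
  have hsup : ⨆ t, ‖(M₁ t * P) * Matrix.diagonal lam * (M₁ t * P)ᵀ‖ ≤ q ^ 2 * L := by
    refine ciSup_le fun t => ?_
    have hq0 : 0 ≤ q := (norm_nonneg _).trans (h.norm_M₁ t)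
    calc ‖(M₁ t * P) * Matrix.diagonal lam * (M₁ t * P)ᵀ‖
        ≤ (‖M₁ t * P‖ * ‖Matrix.diagonal lam‖) * ‖(M₁ t * P)ᵀ‖ :=
          (Matrix.l2_opNorm_mul _ _).trans
            (mul_le_mul_of_nonneg_right (Matrix.l2_opNorm_mul _ _) (norm_nonneg _))
      _ ≤ (q * L) * q := by
          rw [l2_opNorm_transpose]
          gcongr
          · exact h.norm_M₁ t
          · exact l2_opNorm_diagonal_le hL fun j => by
              rw [abs_of_nonneg (hlam0 j)]; exact hlam j
          · exact h.norm_M₁ t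
      _ = q ^ 2 * L := by ring
  refine havg.trans ?_
  exact mul_le_mul (le_max_left _ _) hsup (Real.iSup_nonneg fun t => norm_nonneg _)
    (le_max_right _ _)

lemma CorrelationModel.l2_opNorm_mul_le {P : Matrix (Fin n) (Fin r) ℝ}
    {M : Fin α → Matrix (Fin n) (Fin n) ℝ} {m : Fin α → ℕ}
    {M₂ : (t : Fin α) → Matrix (Fin n) (Fin (m t)) ℝ}
    {M₁ : (t : Fin α) → Matrix (Fin (m t)) (Fin n) ℝ} {q β : ℝ}
    (h : CorrelationModel P M M₂ M₁ q β) (t : Fin α) : ‖M t * P‖ ≤ 1 := by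
  rw [h.factor t, Matrix.mul_assoc]
  calc ‖M₂ t * (M₁ t * P)‖ ≤ ‖M₂ t‖ * ‖M₁ t * P‖ := Matrix.l2_opNorm_mul _ _
    _ ≤ 1 * 1 := by
        gcongr
        · exact h.norm_M₂ t
        · exact (h.norm_M₁ t).trans h.q_lt_one.le
    _ = 1 := one_mul 1

/-- The mean of the empirical covariance is `P Λ P'` up to a perturbation of size
`0.75 r ζ λ⁻`. -/
lemma CorrelationModel.l2_opNorm_bias_le {P : Matrix (Fin n) (Fin r) ℝ} (hP : Pᵀ * P = 1)
    {M : Fin α → Matrix (Fin n) (Fin n) ℝ} {m : Fin α → ℕ}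
    {M₂ : (t : Fin α) → Matrix (Fin n) (Fin (m t)) ℝ}
    {M₁ : (t : Fin α) → Matrix (Fin (m t)) (Fin n) ℝ} {q β ζ : ℝ}
    (h : CorrelationModel P M M₂ M₁ q β) (hr : 0 < r) (hα : 0 < α) (hlam : ∀ j, 0 < lam j)
    (hζ : 0 < ζ) (hrζ : r * ζ ≤ 0.01)
    (hβ : 0 < q → β / α ≤ betaBound r q (condNumber lam) ζ) :
    ‖(1 / (α : ℝ)) • ∑ t, ((P + M t * P) * Matrix.diagonal lam * (P + M t * P)ᵀ) -
      P * Matrix.diagonal lam * Pᵀ‖ ≤ 0.75 * (r * ζ) * lamMin lam := by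
  have hα' : (0 : ℝ) < α := by exact_mod_cast hα
  set l := lamMin lam with hl
  set L := lamMax lam with hL
  set ε : ℝ := r * ζ with hε
  have hl0 : 0 < l := lamMin_pos hr hlam
  have hL0 : 0 < L := (hlam ⟨0, hr⟩).trans_le (le_lamMax _)
  have hε0 : 0 < ε := mul_pos (by exact_mod_cast hr) hζ
  have hq0 : 0 ≤ q := (norm_nonneg _).trans (h.norm_M₁ ⟨0, hα⟩)
  set Q := (1 / (α : ℝ)) • ∑ t, (M t * P) * Matrix.diagonal lam * (M t * P)ᵀ with hQ
  set N := (1 / (α : ℝ)) • ∑ t, P * Matrix.diagonal lam * (M t * P)ᵀ with hN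
  have hQn : ‖Q‖ ≤ max (β / α) 0 * (q ^ 2 * L) :=
    h.l2_opNorm_noise_le hα (fun j => (hlam j).le) le_lamMax hL0.le
  have hNn : ‖N‖ ^ 2 ≤ L * ‖Q‖ :=
    l2_opNorm_cross_sq_le hα hP (fun j => (hlam j).le) le_lamMax hL0.le _
  have hbounds : ‖Q‖ ≤ 0.25 * ε * l ∧ L * ‖Q‖ ≤ (0.25 * ε * l) ^ 2 := by
    -- For `q = 0` the noise term vanishes and no bound on `β / α` is needed.
    rcases hq0.eq_or_lt with hq | hq
    · have : ‖Q‖ = 0 := le_antisymm (by simpa [← hq] using hQn) (norm_nonneg _)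
      rw [this]
      constructor
      · positivity
      · rw [mul_zero]; positivity
    · have hf : condNumber lam = L / l := rfl
      have hb := hβ hq
      rw [betaBound, hf, ← hε] at hb
      set u := ε ^ 2 / (4.1 * (q * (L / l)) ^ 2) with hu
      set v := ε / (q ^ 2 * (L / l)) with hv
      have hu0 : 0 < u := by positivity
      have hv0 : 0 < v := by positivity
      have hc : ((1 - ε) / 2) ^ 2 ≤ 1 / 4 := by nlinarith
      have hmax : ∀ w, min u v ≤ w → max (β / α) 0 ≤ 1 / 4 * w := by
        intro w hw
        have hm0 : 0 ≤ min u v := (lt_min hu0 hv0).le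
        refine max_le (hb.trans ?_) (by linarith)
        exact mul_le_mul hc hw hm0 (by norm_num)
      constructor
      · calc ‖Q‖ ≤ (1 / 4 * v) * (q ^ 2 * L) := hQn.trans (by
              gcongr; exact hmax v (min_le_right _ _))
          _ = 0.25 * ε * l := by rw [hv]; field_simp; norm_num
      · calc L * ‖Q‖ ≤ L * ((1 / 4 * u) * (q ^ 2 * L)) := by
              gcongr
              exact hQn.trans (by gcongr; exact hmax u (min_le_left _ _))
          -- `16.4 = 4 * 4.1`, just enough to stay below `(1 / 4) ^ 2 = 1 / 16`.
          _ = 1 / 16.4 * (ε * l) ^ 2 := by rw [hu]; field_simp; norm_num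
          _ ≤ (0.25 * ε * l) ^ 2 := by nlinarith [sq_nonneg (ε * l)]
  have hNn' : ‖N‖ ≤ 0.25 * ε * l :=
    le_of_sq_le_sq (hNn.trans hbounds.2) (by positivity)
  have hdecomp : (1 / (α : ℝ)) • ∑ t, ((P + M t * P) * Matrix.diagonal lam * (P + M t * P)ᵀ) -
      P * Matrix.diagonal lam * Pᵀ = N + Nᵀ + Q := by
    have hterm : ∀ t, (P + M t * P) * Matrix.diagonal lam * (P + M t * P)ᵀ =
        P * Matrix.diagonal lam * Pᵀ + (P * Matrix.diagonal lam * (M t * P)ᵀ +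
        (P * Matrix.diagonal lam * (M t * P)ᵀ)ᵀ +
        (M t * P) * Matrix.diagonal lam * (M t * P)ᵀ) := by
      intro t
      have : (P * Matrix.diagonal lam * (M t * P)ᵀ)ᵀ = (M t * P) * Matrix.diagonal lam * Pᵀ := by
        rw [Matrix.transpose_mul, Matrix.transpose_transpose, Matrix.transpose_mul,
          Matrix.diagonal_transpose, ← Matrix.mul_assoc]
      rw [this, Matrix.transpose_add, Matrix.add_mul, Matrix.mul_add, Matrix.add_mul,
        Matrix.add_mul]
      abel
    have hconst : (1 / (α : ℝ)) • ∑ _t : Fin α, P * Matrix.diagonal lam * Pᵀ =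
        P * Matrix.diagonal lam * Pᵀ := by
      rw [Finset.sum_const, Finset.card_univ, Fintype.card_fin, ← Nat.cast_smul_eq_nsmul ℝ,
        smul_smul, one_div, inv_mul_cancel₀ hα'.ne', one_smul]
    simp only [hterm]
    rw [Finset.sum_add_distrib, smul_add, hconst, add_sub_cancel_left, Finset.sum_add_distrib,
      Finset.sum_add_distrib, smul_add, smul_add, hN, hQ, Matrix.transpose_smul,
      Matrix.transpose_sum]
  rw [hdecomp]
  calc ‖N + Nᵀ + Q‖ ≤ ‖N‖ + ‖Nᵀ‖ + ‖Q‖ :=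
        (norm_add_le _ _).trans (add_le_add_left (norm_add_le _ _) _)
    _ ≤ 0.25 * ε * l + 0.25 * ε * l + 0.25 * ε * l := by
        rw [l2_opNorm_transpose]
        gcongr
        exact hbounds.1
    _ = 0.75 * ε * l := by ring

/-! ### Fluctuation of the empirical covariance -/

variable {Ω : Type*} [MeasurableSpace Ω] {μ : Measure Ω}
  {a : Fin α → Ω → Fin r → ℝ} {η : ℝ}

lemma CoeffModel.integral_mul (h : CoeffModel μ a lam η) (t : Fin α) (i j : Fin r) :
    ∫ ω, a t ω i * a t ω j ∂μ = Matrix.diagonal lam i j := by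
  rw [← h.cov_eq t, covMatrix, Matrix.of_apply, covariance]
  simp only [h.zero_mean, sub_zero]

variable [IsProbabilityMeasure μ]

lemma CoeffModel.integrable_mul (h : CoeffModel μ a lam η) (t : Fin α) (i j : Fin r) :
    Integrable (fun ω => a t ω i * a t ω j) μ := by
  have hm := h.measurable t
  have hmi : ∀ i, Measurable fun ω => a t ω i := fun i => (measurable_pi_apply i).comp hm
  refine Integrable.of_bound ((hmi i).mul (hmi j)).aestronglyMeasurable
    ((η * lam i + η * lam j) / 2) ?_
  filter_upwards [h.bounded t i, h.bounded t j] with ω h1 h2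
  rw [Real.norm_eq_abs, abs_le]
  constructor <;> nlinarith [sq_nonneg (a t ω i + a t ω j), sq_nonneg (a t ω i - a t ω j)]

/-- The variance `lam j` cannot exceed the almost sure bound `η * lam j`. -/
lemma CoeffModel.one_le_eta (h : CoeffModel μ a lam η) (t : Fin α) (j : Fin r) : 1 ≤ η := by
  have h1 := h.integral_mul t j j
  rw [Matrix.diagonal_apply_eq] at h1
  have h2 : ∫ ω, a t ω j * a t ω j ∂μ ≤ ∫ _ω, η * lam j ∂μ := by
    refine integral_mono_ae (h.integrable_mul t j j) (integrable_const _) ?_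
    filter_upwards [h.bounded t j] with ω hω
    rwa [← sq]
  rw [h1, integral_const, probReal_univ, one_smul] at h2
  have := h.lam_pos j
  by_contra hcon
  push Not at hcon
  nlinarith

/-- The flattened outer product of a vector with itself. -/
noncomputable def outerVec (y : Fin n → ℝ) : EuclideanSpace ℝ (Fin n × Fin n) :=
  WithLp.toLp 2 fun p => y p.1 * y p.2

lemma measurable_outerVec : Measurable (outerVec (n := n)) := by
  unfold outerVec
  fun_prop

/-- For a rank-one matrix the Frobenius norm loses nothing, so the bound on the summands is free of
`n`. -/
lemma norm_outerVec (y : Fin n → ℝ) : ‖outerVec y‖ = y ⬝ᵥ y := by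
  rw [← sq_eq_sq₀ (norm_nonneg _) (dotProduct_self_nonneg_real y), outerVec, norm_toLp_sq, sq]
  simp only [dotProduct, Fintype.sum_prod_type, Finset.sum_mul_sum]
  exact Finset.sum_congr rfl fun i _ => Finset.sum_congr rfl fun j _ => by ring

lemma CoeffModel.integral_outerVec (h : CoeffModel μ a lam η) (t : Fin α)
    (B : Matrix (Fin n) (Fin r) ℝ) (hI : Integrable (fun ω => outerVec (B *ᵥ a t ω)) μ)
    (p : Fin n × Fin n) :
    (∫ ω, outerVec (B *ᵥ a t ω) ∂μ) p = (B * Matrix.diagonal lam * Bᵀ) p.1 p.2 := by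
  have h1 : (∫ ω, outerVec (B *ᵥ a t ω) ∂μ) p = ∫ ω, outerVec (B *ᵥ a t ω) p ∂μ :=
    ((EuclideanSpace.proj p : EuclideanSpace ℝ (Fin n × Fin n) →L[ℝ] ℝ).integral_comp_comm
      hI).symm
  rw [h1]
  have h2 : ∀ ω, outerVec (B *ᵥ a t ω) p =
      ∑ i, ∑ j, (B p.1 i * B p.2 j) * (a t ω i * a t ω j) := by
    intro ω
    simp only [outerVec, Matrix.mulVec, dotProduct, Finset.sum_mul_sum]
    exact Finset.sum_congr rfl fun i _ => Finset.sum_congr rfl fun j _ => by ring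
  simp only [h2]
  rw [integral_finsetSum _ fun i _ => integrable_finsetSum _ fun j _ =>
    (h.integrable_mul t i j).const_mul _]
  rw [Matrix.mul_apply]
  refine Finset.sum_congr rfl fun i _ => ?_
  rw [integral_finsetSum _ fun j _ => (h.integrable_mul t i j).const_mul _]
  simp only [integral_const_mul, h.integral_mul, Matrix.mul_diagonal, Matrix.transpose_apply]
  rw [Finset.sum_eq_single i]
  · rw [Matrix.diagonal_apply_eq]; ring
  · intro j _ hj
    rw [Matrix.diagonal_apply_ne _ hj.symm, mul_zero]
  · simp

/-- Concentration of the empirical covariance of `B t *ᵥ a t` around its mean. -/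
theorem CoeffModel.measureReal_empCov_deviation_le (h : CoeffModel μ a lam η) (hr : 0 < r)
    (hα : 0 < α) (B : Fin α → Matrix (Fin n) (Fin r) ℝ) (hB : ∀ t, ‖B t‖ ≤ 2) {s : ℝ}
    (hs : 0 < s) :
    ∃ E : Set Ω, MeasurableSet E ∧
      1 - 2 * Real.exp (-(α * s ^ 2 / (2 * (8 * η * r * lamMax lam) ^ 2))) ≤ μ.real E ∧
      ∀ ω ∈ E, ‖empCov (fun t => B t *ᵥ a t ω) -
        (1 / (α : ℝ)) • ∑ t, B t * Matrix.diagonal lam * (B t)ᵀ‖ ≤ s := by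
  have hα' : (0 : ℝ) < α := by exact_mod_cast hα
  have hr' : (0 : ℝ) < r := by exact_mod_cast hr
  have hη : 1 ≤ η := h.one_le_eta ⟨0, hα⟩ ⟨0, hr⟩
  set L := lamMax lam with hL
  have hL0 : 0 < L := (h.lam_pos ⟨0, hr⟩).trans_le (le_lamMax _)
  -- The `4` is the square of `‖B t‖ ≤ 2`, and `r * η * L` bounds the squared length of `a t`.
  -- Centring doubles `K`.
  set K : ℝ := 4 * η * r * L with hK
  have hK0 : 0 < K := by positivity
  set Y : Fin α → Ω → EuclideanSpace ℝ (Fin n × Fin n) := fun t ω => outerVec (B t *ᵥ a t ω)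
    with hY
  have hgm : ∀ t, Measurable fun x : Fin r → ℝ => outerVec (B t *ᵥ x) := fun t =>
    measurable_outerVec.comp (Continuous.measurable (by fun_prop))
  have hYm : ∀ t, Measurable (Y t) := fun t => (hgm t).comp (h.measurable t)
  have hYb : ∀ t, ∀ᵐ ω ∂μ, ‖Y t ω‖ ≤ K := by
    intro t
    filter_upwards [ae_all_iff.2 (h.bounded t)] with ω hω
    simp only [hY, norm_outerVec]
    have h1 : a t ω ⬝ᵥ a t ω ≤ r * (η * L) := by
      have : ∀ j ∈ Finset.univ, a t ω j * a t ω j ≤ η * L := fun j _ => by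
        rw [← sq]
        exact (hω j).trans (mul_le_mul_of_nonneg_left (le_lamMax j) (by linarith))
      simpa [dotProduct] using Finset.sum_le_card_nsmul _ _ _ this
    calc (B t *ᵥ a t ω) ⬝ᵥ (B t *ᵥ a t ω) ≤ ‖B t‖ ^ 2 * (a t ω ⬝ᵥ a t ω) :=
          mulVec_dotProduct_mulVec_le _ _
      _ ≤ 2 ^ 2 * (r * (η * L)) := by
          gcongr
          · exact dotProduct_self_nonneg_real _
          · exact hB t
      _ = K := by rw [hK]; ring
  have hYI : ∀ t, Integrable (Y t) μ := fun t =>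
    Integrable.of_bound (hYm t).aestronglyMeasurable K (hYb t)
  set X : Fin α → Ω → EuclideanSpace ℝ (Fin n × Fin n) := fun t ω => Y t ω - ∫ ω', Y t ω' ∂μ
    with hX
  have hXm : ∀ t, Measurable (X t) := fun t => (hYm t).sub_const _
  have hXb : ∀ t, ∀ᵐ ω ∂μ, ‖X t ω‖ ≤ 8 * η * r * L := by
    intro t
    have h1 : ‖∫ ω', Y t ω' ∂μ‖ ≤ K := by
      simpa using norm_integral_le_of_norm_le_const (hYb t)
    filter_upwards [hYb t] with ω hω
    calc ‖X t ω‖ ≤ ‖Y t ω‖ + ‖∫ ω', Y t ω' ∂μ‖ := norm_sub_le _ _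
      _ ≤ K + K := add_le_add hω h1
      _ = 8 * η * r * L := by rw [hK]; ring
  have hXmean : ∀ t, ∫ ω, X t ω ∂μ = 0 := fun t => by
    simp only [hX]
    rw [integral_sub (hYI t) (integrable_const _), integral_const, probReal_univ, one_smul,
      sub_self]
  have hXind : iIndepFun X μ :=
    h.indep.comp (fun t x => outerVec (B t *ᵥ x) - ∫ ω', Y t ω' ∂μ)
      fun t => (hgm t).sub_const _
  have hconc := measureReal_norm_sum_ge_le (μ := μ) (X := X) (b := 8 * η * r * L) (τ := α * s)
    (by positivity) (by positivity) hXm hXind hXmean hXb (by simpa using hα)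
  have hSm : Measurable fun ω => ‖∑ t, X t ω‖ :=
    (Finset.measurable_fun_sum _ fun t _ => hXm t).norm
  have hmeas : MeasurableSet {ω | α * s ≤ ‖∑ t, X t ω‖} := measurableSet_le measurable_const hSm
  refine ⟨{ω | α * s ≤ ‖∑ t, X t ω‖}ᶜ, hmeas.compl, ?_, fun ω hω => ?_⟩
  · rw [probReal_compl_eq_one_sub hmeas]
    have : (α * s) ^ 2 / (2 * (Fintype.card (Fin α) : ℝ) * (8 * η * r * L) ^ 2) =
        α * s ^ 2 / (2 * (8 * η * r * L) ^ 2) := by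
      rw [Fintype.card_fin]; field_simp
    rw [this] at hconc
    linarith
  · have hω' : ‖∑ t, X t ω‖ ≤ α * s := by
      have : ¬ (α * s ≤ ‖∑ t, X t ω‖) := hω
      exact (not_le.1 this).le
    refine (l2_opNorm_le_frobenius _).trans ?_
    have heq : (WithLp.toLp 2 fun p : Fin n × Fin n => (empCov (fun t => B t *ᵥ a t ω) -
        (1 / (α : ℝ)) • ∑ t, B t * Matrix.diagonal lam * (B t)ᵀ) p.1 p.2 :
          EuclideanSpace ℝ (Fin n × Fin n)) = (1 / (α : ℝ)) • ∑ t, X t ω := by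
      ext p
      have hXp : ∀ t, (X t ω).ofLp p = (B t *ᵥ a t ω) p.1 * (B t *ᵥ a t ω) p.2 -
          (B t * Matrix.diagonal lam * (B t)ᵀ) p.1 p.2 := fun t => by
        rw [← h.integral_outerVec t (B t) (hYI t) p]
        rfl
      simp only [empCov, Matrix.sub_apply, Matrix.smul_apply, Matrix.sum_apply,
        Matrix.vecMulVec_apply, PiLp.smul_apply, WithLp.ofLp_sum, Finset.sum_apply, hXp,
        Finset.sum_sub_distrib, smul_eq_mul, mul_sub]
    rw [heq, norm_smul, Real.norm_of_nonneg (by positivity)]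
    calc 1 / (α : ℝ) * ‖∑ t, X t ω‖ ≤ 1 / (α : ℝ) * (α * s) := by gcongr
      _ = s := by field_simp

end Model

/-! ### Choice of constants and conclusion -/

/-- The sample bound makes the failure probability polynomially small. -/
lemma exp_neg_le_of_sampleBound_le {n r α : ℕ} {lam : Fin r → ℝ} {η q ζ : ℝ} (hn : 0 < n)
    (hr : 0 < r) (hlam : ∀ j, 0 < lam j) (hη : 1 ≤ η) (hζ : 0 < ζ)
    (hα : sampleBound n r η q (condNumber lam) ζ ≤ α) :
    Real.exp (-(α * (0.02 * (r * ζ) * lamMin lam) ^ 2 /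
      (2 * (8 * η * r * lamMax lam) ^ 2))) ≤ (n : ℝ) ^ (-10 : ℤ) := by
  have hn' : (1 : ℝ) ≤ n := by exact_mod_cast hn
  have hr' : (0 : ℝ) < r := by exact_mod_cast hr
  have hlog : 0 ≤ Real.log n := Real.log_nonneg hn'
  set l := lamMin lam with hl
  set L := lamMax lam with hL
  have hl0 : 0 < l := lamMin_pos hr hlam
  have hL0 : 0 < L := (hlam ⟨0, hr⟩).trans_le (le_lamMax _)
  have hf : condNumber lam = L / l := rfl
  set f := L / l with hf'
  have hf0 : 0 < f := by positivity
  have hsample : 32 / 0.01 ^ 2 * η ^ 2 * ((r : ℝ) ^ 2 * (11 * Real.log n) / ((r : ℝ) * ζ) ^ 2)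
      * f ^ 2 ≤ α := by
    refine le_trans ?_ hα
    rw [sampleBound, hf]
    gcongr
    exact le_max_left _ _
  have hkey : 10 * Real.log n ≤
      α * (0.02 * (r * ζ) * l) ^ 2 / (2 * (8 * η * r * L) ^ 2) := by
    calc 10 * Real.log n ≤ 11 * Real.log n := by linarith
      -- The constants cancel exactly: `32 * (0.02 / 0.01) ^ 2 = 2 * 8 ^ 2`.
      _ = 32 / 0.01 ^ 2 * η ^ 2 * ((r : ℝ) ^ 2 * (11 * Real.log n) / ((r : ℝ) * ζ) ^ 2)
          * f ^ 2 * (0.02 * (r * ζ) * l) ^ 2 / (2 * (8 * η * r * L) ^ 2) := by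
          rw [hf']; field_simp; ring
      _ ≤ _ := by gcongr
  calc Real.exp (-(α * (0.02 * (r * ζ) * l) ^ 2 / (2 * (8 * η * r * L) ^ 2)))
      ≤ Real.exp (Real.log n * (-10 : ℤ)) := by
        refine Real.exp_le_exp.2 ?_
        push_cast
        linarith
    _ = (n : ℝ) ^ (-10 : ℤ) := by
        rw [← Real.rpow_def_of_pos (by linarith), Real.rpow_intCast]

/-- Simple-EVD recovery guarantee for correlated PCA. For `q = 0` the upper bound on `β / α` is
infinite, hence imposes nothing. -/
theorem theorem1 {Ω : Type*} [MeasurableSpace Ω] (μ : Measure Ω) [IsProbabilityMeasure μ]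
    (n r α : ℕ) (hr : 0 < r) (hα : 0 < α)
    (P : Matrix (Fin n) (Fin r) ℝ) (hP : IsBasisMatrix P)
    (a : Fin α → Ω → Fin r → ℝ) (lam : Fin r → ℝ) (η : ℝ)
    (M : Fin α → Matrix (Fin n) (Fin n) ℝ) (m : Fin α → ℕ)
    (M₂ : (t : Fin α) → Matrix (Fin n) (Fin (m t)) ℝ)
    (M₁ : (t : Fin α) → Matrix (Fin (m t)) (Fin n) ℝ) (q β : ℝ)
    (ℓ y : Fin α → Ω → Fin n → ℝ)
    (hℓ : ∀ t ω, ℓ t ω = P *ᵥ a t ω)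
    (hy : ∀ t ω, y t ω = ℓ t ω + M t *ᵥ ℓ t ω)
    (ζ : ℝ) (hζ : 0 < ζ) (hrζ : r * ζ ≤ 0.01)
    (hcoeff : CoeffModel μ a lam η)
    (hcorr : CorrelationModel P M M₂ M₁ q β)
    (hβ : 0 < q → β / α ≤ betaBound r q (condNumber lam) ζ)
    (hα₀ : sampleBound n r η q (condNumber lam) ζ ≤ α) :
    ∃ E : Set Ω, MeasurableSet E ∧ 1 - 6 * (n : ℝ) ^ (-10 : ℤ) ≤ μ.real E ∧
      ∀ ω ∈ E, ∀ (U : Matrix (Fin n) (Fin n) ℝ) (d : Fin n → ℝ),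
        IsEVD (empCov fun t => y t ω) U d →
          subspaceError (keepAbove U d (0.95 * lamMin lam)) P ≤ r * ζ := by
  have hn : 0 < n := by
    rcases Nat.eq_zero_or_pos n with rfl | hn
    · exfalso
      have h1 := congrFun (congrFun hP ⟨0, hr⟩) ⟨0, hr⟩
      rw [Matrix.mul_apply, Matrix.one_apply_eq] at h1
      simp at h1
    · exact hn
  have hε0 : 0 < r * ζ := mul_pos (by exact_mod_cast hr) hζ
  have hl0 : 0 < lamMin lam := lamMin_pos hr hcoeff.lam_pos
  have hη : 1 ≤ η := hcoeff.one_le_eta ⟨0, hα⟩ ⟨0, hr⟩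
  have hB : ∀ t, ‖P + M t * P‖ ≤ 2 := fun t => by
    have h1 := norm_add_le P (M t * P)
    have h2 : ‖P‖ ≤ 1 := l2_opNorm_le_one_of_transpose_mul_self hP
    have h3 := hcorr.l2_opNorm_mul_le t
    linarith
  have hyB : ∀ t ω, y t ω = (P + M t * P) *ᵥ a t ω := fun t ω => by
    rw [hy, hℓ, Matrix.add_mulVec, Matrix.mulVec_mulVec]
  obtain ⟨E, hE, hEp, hEd⟩ := hcoeff.measureReal_empCov_deviation_le hr hα
    (fun t => P + M t * P) hB (s := 0.02 * (r * ζ) * lamMin lam) (by positivity)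
  -- The event only controls the deviation of the empirical covariance, so it serves all eigenbases
  -- at once. Its failure probability is at most `2 * n ^ (-10)`.
  refine ⟨E, hE, ?_, fun ω hω U d hU => ?_⟩
  · have h1 := exp_neg_le_of_sampleBound_le hn hr hcoeff.lam_pos hη hζ hα₀
    have h2 : (0 : ℝ) ≤ (n : ℝ) ^ (-10 : ℤ) := by positivity
    linarith
  · simp only [hyB] at hU
    have hbias := hcorr.l2_opNorm_bias_le hP hr hα hcoeff.lam_pos hζ hrζ hβ
    have hdev := hEd ω hω
    set D := empCov fun t => (P + M t * P) *ᵥ a t ω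
    set S := (1 / (α : ℝ)) • ∑ t, ((P + M t * P) * Matrix.diagonal lam * (P + M t * P)ᵀ)
    set T := P * Matrix.diagonal lam * Pᵀ
    refine subspaceError_keepAbove_le (W := D - T) hP hl0 lamMin_le hε0 hrζ
      (add_sub_cancel T D).symm ?_ hU
    calc ‖D - T‖ = ‖(D - S) + (S - T)‖ := by rw [sub_add_sub_cancel]
      _ ≤ 0.02 * (r * ζ) * lamMin lam + 0.75 * (r * ζ) * lamMin lam :=
          (norm_add_le _ _).trans (add_le_add hdev hbias)
      _ ≤ 0.8 * (r * ζ) * lamMin lam := by nlinarith [mul_pos hε0 hl0]
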